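/- **The pillow space.** Let $X_0=[0,1]^2$ with the Euclidean metric, and let $X_1$ be obtained from $X_0$ by subdividing it into nine congruent closed subsquares and doubling the central one: $X_1=(X_0\times\mathbb{Z}_2)/\!\sim$, where $(p,0)\sim(p,1)$ for all $p\notin(1/3,2/3)^2$. Thus $X_1$ is a union of ten squares ("cubes") of side $1/3$. Let $\pi\colon X_1\to X_0$, $\pi[p,b]=p$, let $S_0\colon X_0\to X_0$ be the folding map that applies to both coordinates the function equal to $3t$ on $[0,1/3]$, $2-3t$ on $[1/3,2/3]$, $3t-2$ on $[2/3,1]$, and let $S\colon X_1\to X_0$, $S[p,b]=S_0(p)$. For $n\ge1$ let $$X_n=\{(x_1,\dots,x_n)\in X_1^n:\ \pi(x_{i+1})=S(x_i)\ \text{for } 1\le i<n\}.$$ For each word $(c_1,\dots,c_n)$ of cubes of $X_1$, the set $\{x\in X_n: x_i\in c_i\ \text{for all } i\}$ is a cube of $X_n$, identified with a Euclidean square of side $3^{-n}$ through $x\mapsto 3^{-n}S(x_n)$. Let $d_n(x,y)$ be the infimum of $\sum_{j}3^{-n}|S((z_j)_n)-S((z_{j+1})_n)|$ over all finite chains $x=z_0,\dots,z_m=y$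 in $X_n$ in which consecutive points lie in a common cube. The pillow space is $$X=\{(x_i)_{i\ge1}:\ x_i\in X_1,\ \pi(x_{i+1})=S(x_i)\ \text{for all } i\},\qquad d_0(x,y)=\lim_{n\to\infty}d_n\big((x_1,\dots,x_n),(y_1,\dots,y_n)\big).$$ Let $\Pi\colon X\to[0,1]^2$, $\Pi((x_i))=\pi(x_1)$. For $w\in\mathbb{Z}_2^{\mathbb N}$ let $\iota_w\colon X\to X$, $\iota_w((x_i))=(\iota_{w_i}(x_i))$, where $\iota_b[p,b']=[p,b+b']$, and let $s_w\colon[0,1]^2\to X$, $s_w(p)=([S_0^{i-1}(p),w_i])_{i\ge1}$. A *sheet* of $X$ is the image of some $s_w$. **Terminology.** A metric on $X$ is *symmetric* if every $\iota_w$ is an isometry of it. A homeomorphism $f\colon(Y,d_Y)\to(Z,d_Z)$ is a *quasisymmetry* if there is a homeomorphism $\eta$ of $[0,\infty)$ such that $\frac{d_Z(f(x),f(y))}{d_Z(f(x),f(z))}\le\eta\big(\frac{d_Y(x,y)}{d_Y(x,z)}\big)$ for all $x,y,z$ with $x\ne z$. A map $f\colon Y\to Z$ is a *Lipschitz quotient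 map* if for some $L>0$, $B(f(x),L^{-1}r)\subseteq f(B(x,r))\subseteq B(f(x),Lr)$ for all $x\in Y$, $r>0$. A metric space is *Loewner* if for some $Q>1$ it is Ahlfors $Q$-regular (for all $x$ and $0<r\le 2\operatorname{diam}$, $C^{-1}r^Q\le\mathcal H^Q(B(x,r))\le Cr^Q$) and satisfies the Loewner condition with exponent $Q$: for each $t>0$ there is $c>0$ such that the $Q$-modulus (with respect to $\mathcal H^Q$) of the family of curves joining $E$ to $F$ is at least $c$ for all disjoint nondegenerate continua $E,F$ with $\operatorname{dist}(E,F)\le t\min(\operatorname{diam}E,\operatorname{diam}F)$. **Lemma.** Suppose that $d_{SL}$ is a symmetric Loewner metric on $X$ such that the identity map $(X,d_0)\to(X,d_{SL})$ is a quasisymmetry. Then there is a metric $\rho$ on $[0,1]^2$ with the following properties: (i) the identity map from $[0,1]^2$ with the Euclidean metric to $([0,1]^2,\rho)$ is a quasisymmetry; (ii) $\Pi$ is a Lipschitz quotient map from $(X,d_{SL})$ to $([0,1]^2,\rho)$; (iii) for each sheet $A\subseteq X$, the restriction $\Pi|_A$ is an isometry from $(A,d_{SL})$ onto $([0,1]^2,\rho)$.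 -/

import Mathlib

noncomputable section

namespace PillowSpace

open Set Filter Topology MeasureTheory
open scoped NNReal ENNReal

/-! ### General notions for metric spaces -/

section General

variable {α β : Type*}

/-- Quasisymmetries: homeomorphisms `f` for which there is a homeomorphism `η` of `[0, ∞)` with
`d(f x, f y) / d(f x, f z) ≤ η (d(x, y) / d(x, z))` for all `x, y, z` with `x ≠ z`. -/
def IsQuasisymmetry [MetricSpace α] [MetricSpace β] (f : α → β) : Prop :=
  IsHomeomorph f ∧ ∃ η : ℝ≥0 ≃ₜ ℝ≥0, ∀ x y z : α, x ≠ z →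
    nndist (f x) (f y) / nndist (f x) (f z) ≤ η (nndist x y / nndist x z)

/-- The identity map is a quasisymmetry from `(α, d₁)` to `(α, d₂)`. -/
def IsQuasisymmetricById (d₁ d₂ : MetricSpace α) : Prop :=
  @IsQuasisymmetry α α d₁ d₂ id

/-- Lipschitz quotient maps:
`B(f x, r / L) ⊆ f (B(x, r)) ⊆ B(f x, L r)` for all points `x` and radii `r > 0`. -/
def IsLipschitzQuotient [MetricSpace α] [MetricSpace β] (f : α → β) : Prop :=
  ∃ L : ℝ, 0 < L ∧ ∀ (x : α) (r : ℝ), 0 < r →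
    Metric.ball (f x) (L⁻¹ * r) ⊆ f '' Metric.ball x r ∧
    f '' Metric.ball x r ⊆ Metric.ball (f x) (L * r)

/-- The `Q`-dimensional Hausdorff measure, on the Borel sets of the metric space `α`. -/
def hausdorff (α : Type*) [MetricSpace α] (Q : ℝ) : @Measure α (borel α) :=
  letI : MeasurableSpace α := borel α
  haveI : BorelSpace α := ⟨rfl⟩
  Measure.hausdorffMeasure Q

/-- Ahlfors `Q`-regularity: the `Q`-dimensional Hausdorff measure of `B(x, r)` is comparable to
`r ^ Q` for all points `x` and all radii `0 < r ≤ 2 diam`. -/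
def IsAhlforsRegular (α : Type*) [MetricSpace α] (Q : ℝ) : Prop :=
  ∃ C : ℝ, 0 < C ∧ ∀ (x : α) (r : ℝ), 0 < r →
    ENNReal.ofReal r ≤ 2 * Metric.ediam (univ : Set α) →
    ENNReal.ofReal (C⁻¹ * r ^ Q) ≤ hausdorff α Q (Metric.ball x r) ∧
      hausdorff α Q (Metric.ball x r) ≤ ENNReal.ofReal (C * r ^ Q)

/-- A nonnegative Borel function `g` is admissible for the family of rectifiable curves joining
`E` to `F` if `∫_γ g ds ≥ 1` for each such curve `γ`. Curves are parametrized by arc length,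
on an interval `[0, ℓ]`. -/
def IsAdmissible [MetricSpace α] (E F : Set α) (g : α → ℝ≥0∞) : Prop :=
  @Measurable α ℝ≥0∞ (borel α) _ g ∧
    ∀ (ℓ : ℝ) (γ : ℝ → α), 0 ≤ ℓ → HasUnitSpeedOn γ (Icc 0 ℓ) → γ 0 ∈ E → γ ℓ ∈ F →
      1 ≤ ∫⁻ t in Icc 0 ℓ, g (γ t)

/-- The `Q`-modulus, with respect to the `Q`-dimensional Hausdorff measure, of the family of
curves joining `E` to `F`. -/
def modulus [MetricSpace α] (Q : ℝ) (E F : Set α) : ℝ≥0∞ :=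
  ⨅ (g : α → ℝ≥0∞) (_ : IsAdmissible E F g),
    @lintegral α (borel α) (hausdorff α Q) (fun x => g x ^ Q)

/-- Nondegenerate continua: compact connected sets with more than one point. -/
def IsNondegenerateContinuum [MetricSpace α] (E : Set α) : Prop :=
  IsCompact E ∧ IsConnected E ∧ E.Nontrivial

/-- The Loewner condition with exponent `Q` (for the `Q`-dimensional Hausdorff measure): for
each `t > 0`, the `Q`-moduli of all pairs of disjoint nondegenerate continua with relative
distance `dist(E, F) / min(diam E, diam F)` at most `t` have a positive lower bound.
(The distance of two compact sets is attained.) -/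
def HasLoewnerCondition (α : Type*) [MetricSpace α] (Q : ℝ) : Prop :=
  ∀ t : ℝ, 0 < t → ∃ c : ℝ≥0∞, 0 < c ∧ ∀ E F : Set α,
    IsNondegenerateContinuum E → IsNondegenerateContinuum F → Disjoint E F →
    (∃ x ∈ E, ∃ y ∈ F, dist x y ≤ t * min (Metric.diam E) (Metric.diam F)) →
    c ≤ modulus Q E F

/-- A Loewner space: for some `Q > 1` it is Ahlfors `Q`-regular and satisfies the Loewner
condition with exponent `Q`. -/
def IsLoewner (α : Type*) [MetricSpace α] : Prop :=
  ∃ Q : ℝ, 1 < Q ∧ IsAhlforsRegular α Q ∧ HasLoewnerCondition α Q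

end General

/-! ### The substitution complex `(X₁, X₁, X₀, S, π)` -/

/-- `X₀`: the unit square `[0,1]²` with the Euclidean metric. -/
abbrev UnitSquare : Type :=
  {p : EuclideanSpace ℝ (Fin 2) // ∀ i, p i ∈ Icc (0 : ℝ) 1}

/-- The Euclidean metric of the unit square. -/
@[reducible] def squareMetric : MetricSpace UnitSquare := inferInstance

/-- The open central square `(1/3, 2/3)²`. -/
def centralSquare : Set UnitSquare := {p | ∀ i, p.1 i ∈ Ioo (1 / 3 : ℝ) (2 / 3)}

/-- Two copies of the unit square are glued along the complement of the open central square. -/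
def gluing : Setoid (UnitSquare × Bool) where
  r a b := a.1 = b.1 ∧ (a.2 = b.2 ∨ a.1 ∉ centralSquare)
  iseqv :=
    { refl := fun _ => ⟨rfl, Or.inl rfl⟩
      symm := by
        rintro a b ⟨h, h'⟩
        exact ⟨h.symm, h'.imp Eq.symm (fun k => h ▸ k)⟩
      trans := by
        rintro a b c ⟨h, h'⟩ ⟨k, k'⟩
        refine ⟨h.trans k, ?_⟩
        rcases h' with h' | h'
        · exact k'.imp h'.trans (fun k' => h ▸ k')
        · exact Or.inr h' }

/-- `X₁`: the unit square with its central subsquare doubled. -/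
def X₁ : Type := Quotient gluing

/-- `s_b : X₀ → X₁`: the unit square as the layer `b` of `X₁`. -/
def layer (b : Bool) (p : UnitSquare) : X₁ := Quotient.mk gluing (p, b)

/-- `π : X₁ → X₀`: the two central squares are identified. -/
def collapse : X₁ → UnitSquare := Quotient.lift (fun a => a.1) (fun _ _ h => h.1)

/-- The folding map of `[0,1]`: each third is scaled to `[0,1]`, the middle one reflected. -/
def fold₁ (t : ℝ) : ℝ := if t ≤ 1 / 3 then 3 * t else if t ≤ 2 / 3 then 2 - 3 * t else 3 * t - 2

lemma fold₁_mem {t : ℝ} (ht : t ∈ Icc (0 : ℝ) 1) : fold₁ t ∈ Icc (0 : ℝ) 1 := by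
  obtain ⟨h0, h1⟩ := ht
  unfold fold₁
  split_ifs <;> constructor <;> linarith

/-- The folding map of the square: each of the nine subsquares is scaled by `3`, with
reflections. -/
def fold (p : UnitSquare) : UnitSquare :=
  ⟨WithLp.toLp 2 (fun i => fold₁ (p.1 i)), fun i => fold₁_mem (p.2 i)⟩

/-- `S : X₁ → X₀`. -/
def scale : X₁ → UnitSquare :=
  Quotient.lift (fun a => fold a.1) (fun _ _ h => congrArg fold h.1)

/-- The flip by `b ∈ ℤ/2`: it exchanges the two central squares if `b` is true, and is the
identity otherwise. -/
def flip (b : Bool) : X₁ → X₁ :=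
  Quotient.map' (s₁ := gluing) (s₂ := gluing) (fun a => (a.1, xor a.2 b))
    (fun _ _ h => ⟨h.1, h.2.imp (congrArg (xor · b)) id⟩)

@[simp] lemma collapse_layer (b : Bool) (p : UnitSquare) : collapse (layer b p) = p := rfl

@[simp] lemma scale_layer (b : Bool) (p : UnitSquare) : scale (layer b p) = fold p := rfl

@[simp] lemma flip_layer (b b' : Bool) (p : UnitSquare) :
    flip b (layer b' p) = layer (xor b' b) p := rfl

lemma exists_layer (x : X₁) : ∃ b p, layer b p = x := by
  induction x using Quotient.inductionOn with
  | h a => exact ⟨a.2, a.1, rfl⟩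

@[simp] lemma collapse_flip (b : Bool) (x : X₁) : collapse (flip b x) = collapse x := by
  obtain ⟨b', p, rfl⟩ := exists_layer x
  simp

@[simp] lemma scale_flip (b : Bool) (x : X₁) : scale (flip b x) = scale x := by
  obtain ⟨b', p, rfl⟩ := exists_layer x
  simp

/-- The cube of `X₁` in position `k ∈ {0,1,2}²` and layer `b`. For `k ≠ (1,1)` the two layers are
glued, so that `X₁` has ten cubes. -/
def cube (k : Fin 2 → Fin 3) (b : Bool) : Set X₁ :=
  layer b '' {p | ∀ i, p.1 i ∈ Icc ((k i : ℝ) / 3) (((k i : ℝ) + 1) / 3)}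

/-! ### The replacement complexes and their limit -/

/-- The replacement complex `X_{n+1} = {(x₀, …, xₙ) : xᵢ ∈ X₁, π(xᵢ₊₁) = S(xᵢ)}`. -/
structure Stage (n : ℕ) where
  coord : Fin (n + 1) → X₁
  compat : ∀ i : Fin n, collapse (coord i.succ) = scale (coord i.castSucc)

/-- `x` and `y` lie in a common cube of `X_{n+1}`. The cubes of `X_{n+1}` are given by the words
`(c₀, …, cₙ)` of cubes of `X₁`; the cube of this word is the set of all `x` with `xᵢ ∈ cᵢ` for all
`i`. -/
def Stage.InCommonCube {n : ℕ} (x y : Stage n) : Prop :=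
  ∃ (k : Fin (n + 1) → Fin 2 → Fin 3) (b : Fin (n + 1) → Bool),
    ∀ i, x.coord i ∈ cube (k i) (b i) ∧ y.coord i ∈ cube (k i) (b i)

/-- The Euclidean distance of two points of a common cube of `X_{n+1}`. This cube is identified
with the square of side `3^{-(n+1)}` through `x ↦ 3^{-(n+1)} S(xₙ)`: the point `xₙ` determines
`xₙ₋₁, …, x₀` inside of the cube, and `S` maps each cube of `X₁` onto the unit square, scaling
distances by the factor `3`. -/
def Stage.cubeDist {n : ℕ} (x y : Stage n) : ℝ :=
  dist (scale (x.coord (Fin.last n))) (scale (y.coord (Fin.last n))) / 3 ^ (n + 1)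

/-- `r` is the length of an admissible chain `x = z₀, …, z_m = y` in `X_{n+1}`: consecutive
points lie in a common cube. -/
def Stage.IsChainLength {n : ℕ} (x y : Stage n) (r : ℝ) : Prop :=
  ∃ (m : ℕ) (z : ℕ → Stage n), z 0 = x ∧ z m = y ∧
    (∀ i < m, (z i).InCommonCube (z (i + 1))) ∧
    r = ∑ i ∈ Finset.range m, (z i).cubeDist (z (i + 1))

/-- The metric of the cubical complex `X_{n+1}`: the infimum of the lengths of admissible
chains. -/
def Stage.chainDist {n : ℕ} (x y : Stage n) : ℝ := sInf {r | x.IsChainLength y r}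

/-- The underlying set of the pillow space: sequences `(xᵢ)` in `X₁` with
`π(xᵢ₊₁) = S(xᵢ)`. -/
@[ext] structure Pillow where
  coord : ℕ → X₁
  compat : ∀ i, collapse (coord (i + 1)) = scale (coord i)

/-- The projection of the pillow space to `X_{n+1}`. -/
def Pillow.toStage (n : ℕ) (x : Pillow) : Stage n where
  coord i := x.coord i
  compat i := x.compat i

/-- The metric `d₀` of the pillow space, as the limit of the metrics of the complexes `Xₙ`. -/
def Pillow.dist₀ (x y : Pillow) : ℝ :=
  limUnder atTop (fun n => (x.toStage n).chainDist (y.toStage n))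

/-- `Π : X → [0,1]²`. -/
def Pillow.proj (x : Pillow) : UnitSquare := collapse (x.coord 0)

/-- The action `ι_w` of `w ∈ (ℤ/2)^ℕ` on the pillow space. -/
def Pillow.flip (w : ℕ → Bool) (x : Pillow) : Pillow where
  coord i := PillowSpace.flip (w i) (x.coord i)
  compat i := by simpa using x.compat i

/-- The embedding `s_w` of the unit square into the pillow space, for `w ∈ (ℤ/2)^ℕ`:
the point `p`, i.e. the sequence `(p, S p, S (S p), …)`, is lifted to the layers `w₀, w₁, …`. -/
def sheetMap (w : ℕ → Bool) (p : UnitSquare) : Pillow where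
  coord i := layer (w i) (fold^[i] p)
  compat i := by simp [Function.iterate_succ_apply']

/-- The sheets of the pillow space are the images of the embeddings `s_w`. -/
def IsSheet (A : Set Pillow) : Prop := ∃ w : ℕ → Bool, A = range (sheetMap w)

/-- Symmetric metrics: all the maps `ι_w` are isometries. -/
def IsSymmetricMetric (d : MetricSpace Pillow) : Prop :=
  ∀ w : ℕ → Bool, @Isometry Pillow Pillow d.toPseudoMetricSpace.toPseudoEMetricSpace
    d.toPseudoMetricSpace.toPseudoEMetricSpace (Pillow.flip w)

/-! ### The function `d₀` is a metric -/

lemma layer_eq_layer {b b' : Bool} {p : UnitSquare} (h : p ∉ centralSquare) :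
    layer b p = layer b' p := Quotient.sound (s := gluing) ⟨rfl, Or.inr h⟩

lemma abs_fold₁_sub (k : Fin 3) {s t : ℝ} (hs : s ∈ Icc ((k : ℝ) / 3) (((k : ℝ) + 1) / 3))
    (ht : t ∈ Icc ((k : ℝ) / 3) (((k : ℝ) + 1) / 3)) :
    |fold₁ s - fold₁ t| = 3 * |s - t| := by
  have h : fold₁ s - fold₁ t = 3 * (s - t) ∨ fold₁ s - fold₁ t = -(3 * (s - t)) := by
    obtain ⟨h1, h2⟩ := hs
    obtain ⟨h3, h4⟩ := ht
    unfold fold₁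
    fin_cases k <;> norm_num at h1 h2 h3 h4 <;> split_ifs <;>
      first
        | (left; linarith)
        | (right; linarith)
  rcases h with h | h <;> rw [h] <;> simp [abs_mul]

lemma dist_fold {k : Fin 2 → Fin 3} {p q : UnitSquare}
    (hp : ∀ i, p.1 i ∈ Icc ((k i : ℝ) / 3) (((k i : ℝ) + 1) / 3))
    (hq : ∀ i, q.1 i ∈ Icc ((k i : ℝ) / 3) (((k i : ℝ) + 1) / 3)) :
    dist (fold p) (fold q) = 3 * dist p q := by
  have h : ∀ i, |(fold p).1 i - (fold q).1 i| = 3 * |p.1 i - q.1 i| := fun i =>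
    abs_fold₁_sub (k i) (hp i) (hq i)
  rw [Subtype.dist_eq, Subtype.dist_eq, EuclideanSpace.dist_eq, EuclideanSpace.dist_eq,
    ← Real.sqrt_sq (show (0 : ℝ) ≤ 3 by norm_num), ← Real.sqrt_mul (by positivity)]
  congr 1
  rw [Finset.mul_sum]
  refine Finset.sum_congr rfl fun i _ => ?_
  rw [Real.dist_eq, Real.dist_eq, h i, mul_pow]

lemma dist_scale {k : Fin 2 → Fin 3} {b : Bool} {x y : X₁} (hx : x ∈ cube k b)
    (hy : y ∈ cube k b) : dist (scale x) (scale y) = 3 * dist (collapse x) (collapse y) := by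
  obtain ⟨p, hp, rfl⟩ := hx
  obtain ⟨q, hq, rfl⟩ := hy
  exact dist_fold hp hq

/-- The height of a point of `X₁` above or below the collapsed square. -/
def bump (p : UnitSquare) : ℝ := max 0 (min (1 / 6 - |p.1 0 - 1 / 2|) (1 / 6 - |p.1 1 - 1 / 2|))

lemma bump_pos {p : UnitSquare} (h : p ∈ centralSquare) : 0 < bump p := by
  have h0 := h 0
  have h1 := h 1
  refine lt_max_of_lt_right (lt_min ?_ ?_)
  · have : |p.1 0 - 1 / 2| < 1 / 6 := by rw [abs_lt]; constructor <;> linarith [h0.1, h0.2]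
    linarith
  · have : |p.1 1 - 1 / 2| < 1 / 6 := by rw [abs_lt]; constructor <;> linarith [h1.1, h1.2]
    linarith

lemma bump_eq_zero {p : UnitSquare} (h : p ∉ centralSquare) : bump p = 0 := by
  refine max_eq_left ?_
  by_contra hc
  push Not at hc
  obtain ⟨h0, h1⟩ := lt_min_iff.1 hc
  refine h fun i => ?_
  fin_cases i
  · have := abs_lt.1 (show |p.1 0 - 1 / 2| < 1 / 6 by linarith)
    constructor <;> simp <;> linarith [this.1, this.2]
  · have := abs_lt.1 (show |p.1 1 - 1 / 2| < 1 / 6 by linarith)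
    constructor <;> simp <;> linarith [this.1, this.2]

lemma abs_coord_sub_le (p q : UnitSquare) (i : Fin 2) : |p.1 i - q.1 i| ≤ dist p q := by
  have := PiLp.norm_apply_le (p.1 - q.1) i
  rwa [← dist_eq_norm] at this

lemma abs_bump_sub_le (p q : UnitSquare) : |bump p - bump q| ≤ dist p q := by
  have h0 := abs_coord_sub_le p q 0
  have h1 := abs_coord_sub_le p q 1
  have e : ∀ i, |(1 / 6 - |p.1 i - 1 / 2|) - (1 / 6 - |q.1 i - 1 / 2|)| ≤ |p.1 i - q.1 i| := by
    intro i
    have := abs_abs_sub_abs_le_abs_sub (q.1 i - 1 / 2) (p.1 i - 1 / 2)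
    calc _ = |(|q.1 i - 1 / 2| - |p.1 i - 1 / 2|)| := by congr 1; ring
      _ ≤ _ := this
      _ = |p.1 i - q.1 i| := by rw [abs_sub_comm]; congr 1; ring
  unfold bump
  refine (abs_max_sub_max_le_max _ _ _ _).trans (max_le (by simp) ?_)
  exact (abs_min_sub_min_le_max _ _ _ _).trans
    (max_le ((e 0).trans h0) ((e 1).trans h1))

/-- The signed height on `X₁`, which separates the two central squares. -/
def height : X₁ → ℝ :=
  Quotient.lift (fun a => if a.2 then bump a.1 else -bump a.1) (by
    rintro ⟨p, b⟩ ⟨q, b'⟩ ⟨h, h'⟩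
    obtain rfl : p = q := h
    rcases h' with h' | h'
    · obtain rfl : b = b' := h'
      rfl
    · simp [bump_eq_zero h'])

lemma height_layer (b : Bool) (p : UnitSquare) :
    height (layer b p) = if b then bump p else -bump p := rfl

lemma eq_of_collapse_height {x y : X₁} (h : collapse x = collapse y)
    (h' : height x = height y) : x = y := by
  obtain ⟨b, p, rfl⟩ := exists_layer x
  obtain ⟨b', q, rfl⟩ := exists_layer y
  obtain rfl : p = q := h
  by_cases hp : p ∈ centralSquare
  · have := bump_pos hp
    rw [height_layer, height_layer] at h'
    cases b <;> cases b' <;> simp at h' ⊢ <;> linarith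
  · exact layer_eq_layer hp

lemma abs_height_sub_le {k : Fin 2 → Fin 3} {b : Bool} {x y : X₁} (hx : x ∈ cube k b)
    (hy : y ∈ cube k b) : |height x - height y| ≤ dist (collapse x) (collapse y) := by
  obtain ⟨p, hp, rfl⟩ := hx
  obtain ⟨q, hq, rfl⟩ := hy
  rw [height_layer, height_layer]
  refine le_trans (le_of_eq ?_) (abs_bump_sub_le p q)
  cases b
  · simp only [Bool.false_eq_true, if_false]
    rw [← abs_neg]; congr 1; ring
  · simp

/-- The inverse of the folding map on the `k`-th third. -/
def branch₁ (k : Fin 3) (u : ℝ) : ℝ := if k = 1 then (2 - u) / 3 else (k + u) / 3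

lemma branch₁_mem (k : Fin 3) {u : ℝ} (hu : u ∈ Icc (0 : ℝ) 1) :
    branch₁ k u ∈ Icc ((k : ℝ) / 3) (((k : ℝ) + 1) / 3) := by
  obtain ⟨h0, h1⟩ := hu
  unfold branch₁
  fin_cases k <;> norm_num <;> constructor <;> linarith

lemma third_subset (k : Fin 3) : Icc ((k : ℝ) / 3) (((k : ℝ) + 1) / 3) ⊆ Icc 0 1 := by
  rintro t ⟨h0, h1⟩
  fin_cases k <;> norm_num at h0 h1 <;> constructor <;> linarith

lemma fold₁_branch₁ (k : Fin 3) {u : ℝ} (hu : u ∈ Icc (0 : ℝ) 1) :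
    fold₁ (branch₁ k u) = u := by
  obtain ⟨h0, h1⟩ := hu
  unfold branch₁ fold₁
  fin_cases k <;> norm_num <;> split_ifs <;> linarith

lemma branch₁_fold₁ (k : Fin 3) {t : ℝ} (ht : t ∈ Icc ((k : ℝ) / 3) (((k : ℝ) + 1) / 3)) :
    branch₁ k (fold₁ t) = t := by
  obtain ⟨h0, h1⟩ := ht
  unfold branch₁ fold₁
  fin_cases k <;> norm_num at h0 h1 ⊢ <;> split_ifs <;> linarith

/-- The inverse of `S` on a cube of `X₁`. -/
def cubeMap (k : Fin 2 → Fin 3) (b : Bool) (p : UnitSquare) : X₁ :=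
  layer b ⟨WithLp.toLp 2 (fun i => branch₁ (k i) (p.1 i)),
    fun i => third_subset _ (branch₁_mem (k i) (p.2 i))⟩

lemma cubeMap_mem (k : Fin 2 → Fin 3) (b : Bool) (p : UnitSquare) :
    cubeMap k b p ∈ cube k b :=
  ⟨_, fun i => branch₁_mem (k i) (p.2 i), rfl⟩

@[simp] lemma scale_cubeMap (k : Fin 2 → Fin 3) (b : Bool) (p : UnitSquare) :
    scale (cubeMap k b p) = p := by
  apply Subtype.ext
  ext i
  exact fold₁_branch₁ (k i) (p.2 i)

lemma cubeMap_scale {k : Fin 2 → Fin 3} {b : Bool} {x : X₁} (hx : x ∈ cube k b) :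
    cubeMap k b (scale x) = x := by
  obtain ⟨p, hp, rfl⟩ := hx
  unfold cubeMap
  congr 1
  apply Subtype.ext
  ext i
  exact branch₁_fold₁ (k i) (hp i)

lemma exists_mem_cube (x : X₁) : ∃ k b, x ∈ cube k b := by
  obtain ⟨b, p, rfl⟩ := exists_layer x
  have h : ∀ i, ∃ k : Fin 3, p.1 i ∈ Icc ((k : ℝ) / 3) (((k : ℝ) + 1) / 3) := by
    intro i
    obtain ⟨h0, h1⟩ := p.2 i
    by_cases h : p.1 i ≤ 1 / 3
    · exact ⟨0, by constructor <;> norm_num <;> linarith⟩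
    · by_cases h' : p.1 i ≤ 2 / 3
      · exact ⟨1, by constructor <;> norm_num <;> linarith⟩
      · exact ⟨2, by constructor <;> norm_num <;> linarith⟩
  choose k hk using h
  exact ⟨k, b, p, hk, rfl⟩

/-- Each cube of `X₁` shares a corner with the central cube. -/
lemma exists_corner (k : Fin 2 → Fin 3) (b : Bool) :
    ∃ p, cubeMap k b p = cubeMap (fun _ => 1) false p := by
  have h : ∀ j : Fin 3, ∃ u ∈ Icc (0 : ℝ) 1, branch₁ j u = branch₁ 1 u ∧
      branch₁ 1 u ∉ Ioo (1 / 3 : ℝ) (2 / 3) := by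
    intro j
    fin_cases j
    · exact ⟨1, by norm_num, by norm_num [branch₁], by norm_num [branch₁]⟩
    · exact ⟨1, by norm_num, by norm_num [branch₁], by norm_num [branch₁]⟩
    · exact ⟨0, by norm_num, by norm_num [branch₁], by norm_num [branch₁]⟩
  choose u hu h1 h2 using h
  refine ⟨⟨WithLp.toLp 2 (fun i => u (k i)), fun i => hu (k i)⟩, ?_⟩
  simp only [cubeMap, h1]
  exact layer_eq_layer fun hc => h2 (k 0) (hc 0)

namespace Stage

variable {n : ℕ}

lemma cubeDist_nonneg (x y : Stage n) : 0 ≤ x.cubeDist y := by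
  unfold cubeDist; positivity

lemma IsChainLength.refl (x : Stage n) : x.IsChainLength x 0 :=
  ⟨0, fun _ => x, rfl, rfl, by simp, by simp⟩

lemma IsChainLength.single {x y : Stage n} (h : x.InCommonCube y) :
    x.IsChainLength y (x.cubeDist y) :=
  ⟨1, fun i => if i = 0 then x else y, by simp, by simp, by simpa using h, by simp⟩

lemma IsChainLength.nonneg {x y : Stage n} {r : ℝ} (h : x.IsChainLength y r) : 0 ≤ r := by
  obtain ⟨m, z, -, -, -, rfl⟩ := h
  exact Finset.sum_nonneg fun i _ => cubeDist_nonneg _ _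

lemma IsChainLength.trans {x y w : Stage n} {r s : ℝ} (h : x.IsChainLength y r)
    (h' : y.IsChainLength w s) : x.IsChainLength w (r + s) := by
  obtain ⟨m, z, z0, zm, hz, rfl⟩ := h
  obtain ⟨m', z', z0', zm', hz', rfl⟩ := h'
  have e1 : ∀ i ≤ m, (fun i => if i ≤ m then z i else z' (i - m)) i = z i := by
    intro i hi; simp [hi]
  have e2 : ∀ i, (fun i => if i ≤ m then z i else z' (i - m)) (m + i) = z' i := by
    intro i
    rcases Nat.eq_zero_or_pos i with rfl | hi
    · simp [zm, z0']
    · have : ¬ (m + i ≤ m) := by omega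
      simp [this]
  refine ⟨m + m', fun i => if i ≤ m then z i else z' (i - m), ?_, ?_, ?_, ?_⟩
  · rw [e1 0 (Nat.zero_le _), z0]
  · rw [e2, zm']
  · intro i hi
    by_cases him : i < m
    · rw [e1 i him.le, e1 (i + 1) him]
      exact hz i him
    · obtain ⟨j, rfl⟩ := Nat.exists_eq_add_of_le (not_lt.1 him)
      rw [e2, add_assoc, e2]
      exact hz' j (by omega)
  · rw [Finset.sum_range_add]
    congr 1
    · refine Finset.sum_congr rfl fun i hi => ?_
      have hi := Finset.mem_range.1 hi
      rw [e1 i hi.le, e1 (i + 1) hi]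
    · refine Finset.sum_congr rfl fun i hi => ?_
      rw [e2, add_assoc, e2]

lemma InCommonCube.symm {x y : Stage n} (h : x.InCommonCube y) : y.InCommonCube x := by
  obtain ⟨k, b, h⟩ := h
  exact ⟨k, b, fun i => (h i).symm⟩

lemma cubeDist_comm (x y : Stage n) : x.cubeDist y = y.cubeDist x := by
  unfold cubeDist; rw [dist_comm]

lemma IsChainLength.symm {x y : Stage n} {r : ℝ} (h : x.IsChainLength y r) :
    y.IsChainLength x r := by
  obtain ⟨m, z, z0, zm, hz, rfl⟩ := h
  refine ⟨m, fun i => z (m - i), by simpa using zm, by simpa using z0, ?_, ?_⟩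
  · intro i hi
    have := (hz (m - (i + 1)) (by omega)).symm
    rwa [show m - (i + 1) + 1 = m - i by omega] at this
  · rw [← Finset.sum_range_reflect]
    refine Finset.sum_congr rfl fun i hi => ?_
    have hi := Finset.mem_range.1 hi
    rw [cubeDist_comm, show m - 1 - i + 1 = m - i by omega, show m - 1 - i = m - (i + 1) by omega]

/-- The cube distance, computed in the coordinate `i`. -/
lemma dist_collapse_eq {x y : Stage n} (h : x.InCommonCube y) (i : Fin (n + 1)) :
    dist (collapse (x.coord i)) (collapse (y.coord i)) = 3 ^ (i : ℕ) * x.cubeDist y := by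
  obtain ⟨k, b, h⟩ := h
  have key : ∀ i : Fin (n + 1), dist (scale (x.coord i)) (scale (y.coord i)) =
      3 ^ ((i : ℕ) + 1) * x.cubeDist y := by
    intro i
    induction i using Fin.reverseInduction with
    | last => simp only [cubeDist, Fin.val_last]; field_simp
    | cast i ih =>
      rw [dist_scale (h i.succ).1 (h i.succ).2, x.compat, y.compat] at ih
      simp only [Fin.val_succ, Fin.val_castSucc] at ih ⊢
      rw [pow_succ] at ih
      linarith
  have h1 := key i
  rw [dist_scale (h i).1 (h i).2, pow_succ] at h1
  linarith

lemma le_of_isChainLength {D : Stage n → Stage n → ℝ} (h0 : ∀ x, D x x ≤ 0)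
    (h1 : ∀ x y z, D x z ≤ D x y + D y z)
    (h2 : ∀ x y, x.InCommonCube y → D x y ≤ x.cubeDist y) {x y : Stage n} {r : ℝ}
    (h : x.IsChainLength y r) : D x y ≤ r := by
  obtain ⟨m, z, rfl, rfl, hz, rfl⟩ := h
  have : ∀ j ≤ m, D (z 0) (z j) ≤ ∑ i ∈ Finset.range j, (z i).cubeDist (z (i + 1)) := by
    intro j
    induction j with
    | zero => intro _; simpa using h0 (z 0)
    | succ j ih =>
      intro hj
      rw [Finset.sum_range_succ]
      exact (h1 _ (z j) _).trans (add_le_add (ih (by omega)) (h2 _ _ (hz j (by omega))))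
  exact this m le_rfl

/-- The sheet point above `p` in `X_{n+1}`. -/
def section₀ (n : ℕ) (p : UnitSquare) : Stage n := (sheetMap (fun _ => false) p).toStage n

/-- The similarity `F_c : X_{n+1} → X_{n+2}`. -/
def prepend (k : Fin 2 → Fin 3) (b : Bool) (x : Stage n) : Stage (n + 1) where
  coord := Fin.cons (cubeMap k b (collapse (x.coord 0))) x.coord
  compat i := by
    refine Fin.cases ?_ (fun j => ?_) i
    · simp
    · simpa only [Fin.castSucc_succ, Fin.cons_succ, ← Fin.succ_castSucc] using x.compat j

lemma IsChainLength.prepend (k : Fin 2 → Fin 3) (b : Bool) {x y : Stage n} {r : ℝ}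
    (h : x.IsChainLength y r) : (x.prepend k b).IsChainLength (y.prepend k b) (r / 3) := by
  obtain ⟨m, z, rfl, rfl, hz, rfl⟩ := h
  refine ⟨m, fun i => (z i).prepend k b, rfl, rfl, ?_, ?_⟩
  · intro i hi
    obtain ⟨k', b', h⟩ := hz i hi
    refine ⟨Fin.cons k k', Fin.cons b b', fun j => ?_⟩
    refine Fin.cases ?_ (fun j => ?_) j
    · exact ⟨cubeMap_mem _ _ _, cubeMap_mem _ _ _⟩
    · exact h j
  · rw [Finset.sum_div]
    refine Finset.sum_congr rfl fun i _ => ?_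
    simp only [cubeDist, Stage.prepend, ← Fin.succ_last, Fin.cons_succ]
    rw [pow_succ _ (n + 1), div_div]

lemma exists_prepend (x : Stage (n + 1)) : ∃ k b, ∃ y : Stage n, y.prepend k b = x := by
  obtain ⟨k, b, h⟩ := exists_mem_cube (x.coord 0)
  refine ⟨k, b, ⟨Fin.tail x.coord, fun i => ?_⟩, ?_⟩
  · exact x.compat i.succ
  · obtain ⟨c, hc⟩ := x
    simp only [prepend, Stage.mk.injEq]
    have h0 := hc 0
    simp only [Fin.tail] at *
    rw [h0]
    simp only [Fin.castSucc_zero]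
    rw [cubeMap_scale h]
    exact Fin.cons_self_tail c

lemma dist_le_two (p q : UnitSquare) : dist p q ≤ 2 := by
  have h : ∀ i, dist (p.1 i) (q.1 i) ^ 2 ≤ 1 := by
    intro i
    have := Real.dist_le_of_mem_Icc_01 (p.2 i) (q.2 i)
    exact pow_le_one₀ dist_nonneg this
  rw [Subtype.dist_eq, EuclideanSpace.dist_eq, Fin.sum_univ_two]
  refine Real.sqrt_le_iff.2 ⟨by norm_num, ?_⟩
  linarith [h 0, h 1]

lemma exists_chain (n : ℕ) : ∀ x y : Stage n, ∃ r ≤ 2, x.IsChainLength y r := by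
  induction n with
  | zero =>
    have key : ∀ (k : Fin 2 → Fin 3) (b : Bool) (x y : Stage 0),
        x.coord 0 ∈ cube k b → y.coord 0 ∈ cube k b → ∃ r ≤ 2 / 3, x.IsChainLength y r := by
      intro k b x y hx hy
      refine ⟨_, ?_, IsChainLength.single ⟨fun _ => k, fun _ => b, fun i => ?_⟩⟩
      · unfold cubeDist
        have := dist_le_two (scale (x.coord (Fin.last 0))) (scale (y.coord (Fin.last 0)))
        norm_num at this ⊢
        linarith
      · obtain rfl : i = 0 := Fin.fin_one_eq_zero i
        exact ⟨hx, hy⟩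
    intro x y
    obtain ⟨k, b, hx⟩ := exists_mem_cube (x.coord 0)
    obtain ⟨k', b', hy⟩ := exists_mem_cube (y.coord 0)
    obtain ⟨p, hp⟩ := exists_corner k b
    obtain ⟨q, hq⟩ := exists_corner k' b'
    obtain ⟨r₁, h₁, c₁⟩ := key k b x ⟨fun _ => cubeMap k b p, fun i => i.elim0⟩ hx
      (cubeMap_mem _ _ _)
    obtain ⟨r₂, h₂, c₂⟩ := key (fun _ => 1) false ⟨fun _ => cubeMap k b p, fun i => i.elim0⟩
      ⟨fun _ => cubeMap k' b' q, fun i => i.elim0⟩ (by rw [hp]; exact cubeMap_mem _ _ _)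
      (by rw [hq]; exact cubeMap_mem _ _ _)
    obtain ⟨r₃, h₃, c₃⟩ := key k' b' ⟨fun _ => cubeMap k' b' q, fun i => i.elim0⟩ y
      (cubeMap_mem _ _ _) hy
    exact ⟨_, by linarith, (c₁.trans c₂).trans c₃⟩
  | succ n ih =>
    intro x y
    obtain ⟨k, b, x, rfl⟩ := exists_prepend x
    obtain ⟨k', b', y, rfl⟩ := exists_prepend y
    obtain ⟨p, hp⟩ := exists_corner k b
    obtain ⟨q, hq⟩ := exists_corner k' b'
    have hp' : (section₀ n p).prepend k b = (section₀ n p).prepend (fun _ => 1) false := by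
      simp only [prepend, Stage.mk.injEq]
      congr 1
    have hq' : (section₀ n q).prepend k' b' = (section₀ n q).prepend (fun _ => 1) false := by
      simp only [prepend, Stage.mk.injEq]
      congr 1
    obtain ⟨r₁, h₁, c₁⟩ := ih x (section₀ n p)
    obtain ⟨r₂, h₂, c₂⟩ := ih (section₀ n p) (section₀ n q)
    obtain ⟨r₃, h₃, c₃⟩ := ih (section₀ n q) y
    have c₁ := c₁.prepend k b
    have c₂ := c₂.prepend (fun _ => 1) false
    have c₃ := c₃.prepend k' b'
    rw [hp'] at c₁
    rw [hq'] at c₃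
    exact ⟨_, by linarith, (c₁.trans c₂).trans c₃⟩

lemma bddBelow_chain (x y : Stage n) : BddBelow {r | x.IsChainLength y r} :=
  ⟨0, fun _ h => h.nonneg⟩

lemma nonempty_chain (x y : Stage n) : {r | x.IsChainLength y r}.Nonempty :=
  let ⟨r, _, h⟩ := exists_chain n x y
  ⟨r, h⟩

lemma chainDist_le {x y : Stage n} {r : ℝ} (h : x.IsChainLength y r) : x.chainDist y ≤ r :=
  csInf_le (bddBelow_chain x y) h

lemma chainDist_nonneg (x y : Stage n) : 0 ≤ x.chainDist y :=
  le_csInf (nonempty_chain x y) fun _ h => h.nonneg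

lemma chainDist_le_two (x y : Stage n) : x.chainDist y ≤ 2 := by
  obtain ⟨r, hr, h⟩ := exists_chain n x y
  exact (chainDist_le h).trans hr

lemma chainDist_self (x : Stage n) : x.chainDist x = 0 :=
  le_antisymm (chainDist_le (.refl x)) (chainDist_nonneg x x)

lemma chainDist_comm (x y : Stage n) : x.chainDist y = y.chainDist x := by
  unfold chainDist
  congr 1
  ext r
  exact ⟨fun h => h.symm, fun h => h.symm⟩

lemma chainDist_triangle (x y z : Stage n) : x.chainDist z ≤ x.chainDist y + y.chainDist z := by
  refine le_of_forall_pos_lt_add fun ε hε => ?_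
  obtain ⟨r, hr, hr'⟩ := exists_lt_of_csInf_lt (nonempty_chain x y)
    (show x.chainDist y < x.chainDist y + ε / 2 by linarith)
  obtain ⟨s, hs, hs'⟩ := exists_lt_of_csInf_lt (nonempty_chain y z)
    (show y.chainDist z < y.chainDist z + ε / 2 by linarith)
  linarith [chainDist_le (IsChainLength.trans hr hs)]

lemma le_chainDist {D : Stage n → Stage n → ℝ} (h0 : ∀ x, D x x ≤ 0)
    (h1 : ∀ x y z, D x z ≤ D x y + D y z)
    (h2 : ∀ x y, x.InCommonCube y → D x y ≤ x.cubeDist y) (x y : Stage n) :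
    D x y ≤ x.chainDist y :=
  le_csInf (nonempty_chain x y) fun _ h => le_of_isChainLength h0 h1 h2 h

/-- The transition map `X_{n+2} → X_{n+1}`. -/
def trunc (x : Stage (n + 1)) : Stage n where
  coord i := x.coord i.castSucc
  compat i := x.compat i.castSucc

lemma InCommonCube.trunc {x y : Stage (n + 1)} (h : x.InCommonCube y) :
    x.trunc.InCommonCube y.trunc := by
  obtain ⟨k, b, h⟩ := h
  exact ⟨fun i => k i.castSucc, fun i => b i.castSucc, fun i => h i.castSucc⟩

lemma chainDist_trunc_le (x y : Stage (n + 1)) :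
    x.trunc.chainDist y.trunc ≤ x.chainDist y := by
  refine le_chainDist (D := fun x y => x.trunc.chainDist y.trunc)
    (fun x => (chainDist_self _).le) (fun x y z => chainDist_triangle _ _ _)
    (fun x y h => ?_) x y
  refine (chainDist_le (.single h.trunc)).trans (le_of_eq ?_)
  have h1 := dist_collapse_eq h 0
  have h2 := dist_collapse_eq h.trunc 0
  simp only [Fin.val_zero, pow_zero, one_mul] at h1 h2
  rw [← h1, ← h2]
  rfl

lemma dist_collapse_le (i : Fin (n + 1)) (x y : Stage n) :
    dist (collapse (x.coord i)) (collapse (y.coord i)) ≤ 3 ^ (i : ℕ) * x.chainDist y := by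
  have := le_chainDist
    (D := fun x y => dist (collapse (x.coord i)) (collapse (y.coord i)) / 3 ^ (i : ℕ))
    (fun x => by simp)
    (fun x y z => by rw [← add_div]; gcongr; exact dist_triangle _ _ _)
    (fun x y h => by rw [dist_collapse_eq h i]; field_simp; rfl) x y
  rw [div_le_iff₀ (by positivity)] at this
  linarith

lemma abs_height_le (i : Fin (n + 1)) (x y : Stage n) :
    |height (x.coord i) - height (y.coord i)| ≤ 3 ^ (i : ℕ) * x.chainDist y := by
  have := le_chainDist
    (D := fun x y => |height (x.coord i) - height (y.coord i)| / 3 ^ (i : ℕ))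
    (fun x => by simp)
    (fun x y z => by rw [← add_div]; gcongr; exact abs_sub_le _ _ _)
    (fun x y h => by
      rw [div_le_iff₀ (by positivity), mul_comm, ← dist_collapse_eq h i]
      obtain ⟨k, b, h⟩ := h
      exact abs_height_sub_le (h i).1 (h i).2) x y
  rw [div_le_iff₀ (by positivity)] at this
  linarith

end Stage

namespace Pillow

lemma monotone_chainDist (x y : Pillow) :
    Monotone (fun n => (x.toStage n).chainDist (y.toStage n)) :=
  monotone_nat_of_le_succ fun n =>
    Stage.chainDist_trunc_le (x.toStage (n + 1)) (y.toStage (n + 1))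

lemma tendsto_dist₀ (x y : Pillow) :
    Tendsto (fun n => (x.toStage n).chainDist (y.toStage n)) atTop (𝓝 (dist₀ x y)) :=
  tendsto_nhds_limUnder ⟨_, tendsto_atTop_ciSup (monotone_chainDist x y)
    ⟨2, by rintro _ ⟨n, rfl⟩; exact Stage.chainDist_le_two _ _⟩⟩

lemma chainDist_le_dist₀ (n : ℕ) (x y : Pillow) :
    (x.toStage n).chainDist (y.toStage n) ≤ dist₀ x y :=
  (monotone_chainDist x y).ge_of_tendsto (tendsto_dist₀ x y) n

lemma eq_of_dist₀_eq_zero {x y : Pillow} (h : dist₀ x y = 0) : x = y := by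
  ext i
  have h0 : (x.toStage i).chainDist (y.toStage i) ≤ 0 := (chainDist_le_dist₀ i x y).trans h.le
  have h1 := Stage.dist_collapse_le (Fin.last i) (x.toStage i) (y.toStage i)
  have h2 := Stage.abs_height_le (Fin.last i) (x.toStage i) (y.toStage i)
  have h3 : (3 : ℝ) ^ ((Fin.last i : Fin (i + 1)) : ℕ) *
      (x.toStage i).chainDist (y.toStage i) ≤ 0 :=
    mul_nonpos_of_nonneg_of_nonpos (by positivity) h0
  refine eq_of_collapse_height (dist_le_zero.1 (h1.trans h3)) ?_
  exact sub_eq_zero.1 (abs_nonpos_iff.1 (h2.trans h3))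

end Pillow

/-- The pillow space `(X, d₀)` as a metric space. -/
@[reducible] def pillowMetric : MetricSpace Pillow where
  dist := Pillow.dist₀
  dist_self x := tendsto_nhds_unique (Pillow.tendsto_dist₀ x x)
    (by simpa only [Stage.chainDist_self] using tendsto_const_nhds)
  dist_comm x y := tendsto_nhds_unique (Pillow.tendsto_dist₀ x y)
    (by simpa only [Stage.chainDist_comm] using Pillow.tendsto_dist₀ y x)
  dist_triangle x y z := le_of_tendsto_of_tendsto' (Pillow.tendsto_dist₀ x z)
    ((Pillow.tendsto_dist₀ x y).add (Pillow.tendsto_dist₀ y z))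
    fun _ => Stage.chainDist_triangle _ _ _
  eq_of_dist_eq_zero := Pillow.eq_of_dist₀_eq_zero

end PillowSpace

end

/-!
The metric `ρ` is the restriction of `d_SL` to one sheet, `ρ(p, q) = d_SL(s_w p, s_w q)`. Since the
maps `ι_w` are isometries which permute the sheets transitively and commute with `Π`, it does not
depend on `w`, and `Π` is an isometry on every sheet.

The geometric input is that the maps `s_w` are isometric embeddings of the Euclidean square into
`(X, d₀)` (`dist₀_sheetMap`). On the one hand `Π` is `1`-Lipschitz for `d₀` and `Π ∘ s_w = id`. On
the other hand a straight segment in the square is covered by finitely many closed cells of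
generation `n`, on each of which `s_w` maps into a single cube, so the segment can be turned into
an admissible chain whose length is that of the segment (`chainDist_sheetMap_le`, through the
general local-to-global estimate `le_mul_of_finite_closed_cover`).

Hence the quasisymmetry `(X, d₀) → (X, d_SL)` restricts to a quasisymmetry from the square to
`([0,1]², ρ)`. For the Lipschitz quotient property, let `x = s_w p` and `z = s_v q`. The point
`y = s_w q` of the sheet of `x` satisfies `d₀(x, y) = |p - q| ≤ d₀(x, z)`, so that quasisymmetry
gives `ρ(p, q) = d_SL(x, y) ≤ η(1) d_SL(x, z)` (`IsQuasisymmetricById.exists_dist_le`): the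
projection is Lipschitz. Conversely, balls of `ρ` lift to balls of the same radius inside
the sheet of their center.
-/

namespace PillowSpace

open Set Filter Topology
open scoped NNReal

/-! ### Quasisymmetric changes of metric -/

/-- A quasisymmetric change of the metric of `β` restricts to an isometrically embedded space. -/
lemma IsQuasisymmetricById.induced {α β : Type*} {d : MetricSpace α} {d₁ d₂ : MetricSpace β}
    (h : IsQuasisymmetricById d₁ d₂) {f : α → β} (hf : ∀ x y, d₁.dist (f x) (f y) = d.dist x y)
    (hinj : Function.Injective f) :
    IsQuasisymmetricById d (MetricSpace.induced f hinj d₂) := by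
  obtain ⟨hid, η, hη⟩ := h
  have htop : d₁.toUniformSpace.toTopologicalSpace = d₂.toUniformSpace.toTopologicalSpace :=
    (@IsInducing.eq_induced _ _ d₁.toUniformSpace.toTopologicalSpace
      d₂.toUniformSpace.toTopologicalSpace _ (@IsHomeomorph.isInducing _ _
        d₁.toUniformSpace.toTopologicalSpace d₂.toUniformSpace.toTopologicalSpace _ hid)).trans
      induced_id
  have hiso : @Isometry α β d.toPseudoMetricSpace.toPseudoEMetricSpace
      d₁.toPseudoMetricSpace.toPseudoEMetricSpace f :=
    @Isometry.of_dist_eq _ _ d.toPseudoMetricSpace d₁.toPseudoMetricSpace _ hf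
  have hind : d.toUniformSpace.toTopologicalSpace =
      (MetricSpace.induced f hinj d₂).toUniformSpace.toTopologicalSpace :=
    (@IsInducing.eq_induced _ _ d.toUniformSpace.toTopologicalSpace
      d₁.toUniformSpace.toTopologicalSpace _
      (@IsUniformInducing.isInducing _ _ d.toUniformSpace d₁.toUniformSpace _
        (@Isometry.isUniformInducing _ _ d.toPseudoMetricSpace.toPseudoEMetricSpace
          d₁.toPseudoMetricSpace.toPseudoEMetricSpace _ hiso))).trans
      (congrArg (TopologicalSpace.induced f) htop)
  refine ⟨?_, η, fun x y z hxz => ?_⟩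
  · rw [← hind]
    exact IsHomeomorph.id
  · have hnn : ∀ x y, @nndist β d₁.toPseudoMetricSpace.toNNDist (f x) (f y) =
        @nndist α d.toPseudoMetricSpace.toNNDist x y := fun x y => NNReal.eq (hf x y)
    rw [← hnn x y, ← hnn x z]
    exact hη (f x) (f y) (f z) (hinj.ne hxz)

/-- After a quasisymmetric change of metric, a point `y` which was at most as far from `x` as `z`
is still at most a bounded factor farther from `x` than `z`. -/
lemma IsQuasisymmetricById.exists_dist_le {α : Type*} {d₁ d₂ : MetricSpace α}
    (h : IsQuasisymmetricById d₁ d₂) :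
    ∃ K : ℝ, ∀ x y z : α, d₁.dist x y ≤ d₁.dist x z → d₂.dist x y ≤ K * d₂.dist x z := by
  obtain ⟨-, η, hη⟩ := h
  -- Since `η` is increasing, `η 1` would do; a bound of `η` on `[0, 1]` needs only continuity.
  obtain ⟨K, hK⟩ := (isCompact_Icc.image (s := Icc (0 : ℝ≥0) 1) η.continuous).bddAbove
  refine ⟨K, fun x y z hyz => ?_⟩
  rcases eq_or_ne x z with rfl | hxz
  · have : d₁.dist x y ≤ 0 := hyz.trans_eq (d₁.dist_self x)
    have hnonneg : 0 ≤ d₁.dist x y := @dist_nonneg _ d₁.toPseudoMetricSpace x y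
    obtain rfl : x = y := d₁.eq_of_dist_eq_zero (le_antisymm this hnonneg)
    rw [d₂.dist_self, mul_zero]
  · have h1 := (hη x y z hxz).trans (hK ⟨_, ⟨zero_le, div_le_one_of_le₀ hyz zero_le⟩, rfl⟩)
    have hpos : 0 < @nndist α d₂.toPseudoMetricSpace.toNNDist x z :=
      pos_iff_ne_zero.2 fun h0 => hxz (@eq_of_nndist_eq_zero α d₂ x z h0)
    exact_mod_cast (div_le_iff₀ hpos).1 h1

/-! ### A local-to-global estimate -/

/-- If an interval is covered by finitely many closed sets, on each of which the function `D`
subject to the triangle inequality is bounded by `C` times the distance, then the same bound holds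
for the endpoints of the interval. -/
lemma le_mul_of_finite_closed_cover {ι : Type*} [Finite ι] {D : ℝ → ℝ → ℝ} {C a b : ℝ}
    {K : ι → Set ℝ} (hab : a ≤ b) (hself : D a a ≤ 0) (htri : ∀ r s t, D r t ≤ D r s + D s t)
    (hK : ∀ i, IsClosed (K i)) (hcov : Icc a b ⊆ ⋃ i, K i)
    (hD : ∀ i, ∀ s ∈ K i, ∀ t ∈ K i, D s t ≤ C * |s - t|) :
    D a b ≤ C * (b - a) := by
  -- A limit point of a subset of the interval lies in a set `K i` together with points of the
  -- subset that converge to it.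
  have key : ∀ s ⊆ Icc a b, ∀ x ∈ closure s, ∃ i, x ∈ closure (s ∩ K i) ∧ x ∈ K i := by
    intro s hs x hx
    have hs' : s = ⋃ i, s ∩ K i := by
      rw [← inter_iUnion, inter_eq_left.2 (hs.trans hcov)]
    rw [hs', closure_iUnion_of_finite] at hx
    obtain ⟨i, hi⟩ := mem_iUnion.1 hx
    exact ⟨i, hi, (hK i).closure_subset_iff.2 inter_subset_right hi⟩
  let S : Set ℝ := {t | D a t ≤ C * (t - a)}
  have hb : b ∈ S := by
    refine IsClosed.mem_of_ge_of_forall_exists_gt (a := a) ?_ (by simpa [S] using hself) hab ?_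
    · refine isClosed_of_closure_subset fun x hx => ?_
      have hxab : x ∈ Icc a b := closure_minimal inter_subset_right isClosed_Icc hx
      obtain ⟨i, hi, hxi⟩ := key _ inter_subset_right x hx
      refine ⟨?_, hxab⟩
      have hcl : IsClosed {t : ℝ | D a x ≤ C * (t - a) + C * |t - x|} :=
        isClosed_le continuous_const (by fun_prop)
      have := closure_minimal (fun t ht => ?_) hcl hi
      · simpa [S] using this
      · exact (htri a t x).trans (add_le_add ht.1.1 (hD i t ht.2 x hxi))
    · rintro x ⟨hxS, hx⟩
      have hcl : x ∈ closure (Ioc x b) := by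
        rw [closure_Ioc hx.2.ne]
        exact ⟨le_rfl, hx.2.le⟩
      obtain ⟨i, hi, hxi⟩ := key _ (fun t ht => ⟨hx.1.trans ht.1.le, ht.2⟩) x hcl
      obtain ⟨t, ht, hti⟩ := closure_nonempty_iff.1 ⟨x, hi⟩
      refine ⟨t, ?_, ht⟩
      have h1 := hD i x hxi t hti
      rw [abs_sub_comm, abs_of_pos (sub_pos.2 ht.1)] at h1
      have h2 : D a x ≤ C * (x - a) := hxS
      change D a t ≤ C * (t - a)
      linarith [htri a x t]
  exact hb

/-! ### Sheets are isometric to the Euclidean square -/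

lemma continuous_fold₁ : Continuous fold₁ := by
  unfold fold₁
  refine Continuous.if_le (by fun_prop) (Continuous.if_le (by fun_prop) (by fun_prop)
    continuous_id continuous_const fun t ht => ?_) continuous_id continuous_const fun t ht => ?_
  · subst ht; norm_num
  · subst ht; norm_num

lemma continuous_fold : Continuous fold := by
  have := continuous_fold₁
  unfold fold
  fun_prop

lemma exists_forall_mem_third (p : UnitSquare) :
    ∃ k : Fin 2 → Fin 3, ∀ i, p.1 i ∈ Icc ((k i : ℝ) / 3) (((k i : ℝ) + 1) / 3) := by
  obtain ⟨k, b, q, hq, h⟩ := exists_mem_cube (layer false p)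
  obtain rfl : q = p := congrArg collapse h
  exact ⟨k, hq⟩

@[simp] lemma Pillow.proj_sheetMap (w : ℕ → Bool) (p : UnitSquare) : (sheetMap w p).proj = p :=
  rfl

lemma exists_sheetMap_eq (x : Pillow) : ∃ w, sheetMap w x.proj = x := by
  choose w p hp using fun i => exists_layer (x.coord i)
  have hcol : ∀ i, p i = fold^[i] x.proj := by
    intro i
    induction i with
    | zero => exact congrArg collapse (hp 0)
    | succ i ih =>
      have h := x.compat i
      rw [← hp i, ← hp (i + 1), collapse_layer, scale_layer, ih] at h
      rw [h, Function.iterate_succ_apply']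
  refine ⟨w, ?_⟩
  ext i
  rw [← hp i, hcol i]
  rfl

lemma flip_sheetMap_false (w : ℕ → Bool) (p : UnitSquare) :
    Pillow.flip w (sheetMap (fun _ => false) p) = sheetMap w p := by
  ext i
  simp [Pillow.flip, sheetMap]

/-- The closed cell of generation `n + 1` of the square with itinerary `k` under the folding
map. -/
def cell {n : ℕ} (k : Fin (n + 1) → Fin 2 → Fin 3) : Set UnitSquare :=
  {p | ∀ j i, (fold^[(j : ℕ)] p).1 i ∈ Icc ((k j i : ℝ) / 3) (((k j i : ℝ) + 1) / 3)}

lemma isClosed_cell {n : ℕ} (k : Fin (n + 1) → Fin 2 → Fin 3) : IsClosed (cell k) := by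
  simp only [cell, ofPred_forall]
  refine isClosed_iInter fun j => isClosed_iInter fun i => isClosed_Icc.preimage ?_
  have := continuous_fold.iterate (j : ℕ)
  fun_prop

lemma exists_mem_cell (n : ℕ) (p : UnitSquare) :
    ∃ k : Fin (n + 1) → Fin 2 → Fin 3, p ∈ cell k := by
  choose k hk using fun j : Fin (n + 1) => exists_forall_mem_third (fold^[(j : ℕ)] p)
  exact ⟨k, hk⟩

lemma chainDist_sheetMap_le_of_mem_cell {n : ℕ} (w : ℕ → Bool) {k : Fin (n + 1) → Fin 2 → Fin 3}
    {p q : UnitSquare} (hp : p ∈ cell k) (hq : q ∈ cell k) :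
    ((sheetMap w p).toStage n).chainDist ((sheetMap w q).toStage n) ≤ dist p q := by
  have h : ((sheetMap w p).toStage n).InCommonCube ((sheetMap w q).toStage n) :=
    ⟨k, fun j => w j, fun j => ⟨⟨_, hp j, rfl⟩, ⟨_, hq j, rfl⟩⟩⟩
  refine (Stage.chainDist_le (.single h)).trans_eq ?_
  have h0 := Stage.dist_collapse_eq h 0
  rw [Fin.val_zero, pow_zero, one_mul] at h0
  exact h0.symm

/-- The straight segment between two points of the square. -/
noncomputable def segmentMap (p q : UnitSquare) (t : ℝ) : UnitSquare :=
  ⟨AffineMap.lineMap p.1 q.1 (projIcc (0 : ℝ) 1 zero_le_one t : ℝ), fun i => by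
    have ht := (projIcc (0 : ℝ) 1 zero_le_one t).2
    have h := (convex_Icc (0 : ℝ) 1).lineMap_mem (p.2 i) (q.2 i) ht
    simpa [AffineMap.lineMap_apply] using h⟩

lemma dist_segmentMap_le (p q : UnitSquare) (s t : ℝ) :
    dist (segmentMap p q s) (segmentMap p q t) ≤ dist p q * |s - t| := by
  rw [Subtype.dist_eq, segmentMap, segmentMap, dist_lineMap_lineMap, mul_comm, ← Real.dist_eq,
    ← Subtype.dist_eq]
  gcongr
  refine ((LipschitzWith.projIcc (zero_le_one (α := ℝ))).dist_le_mul s t).trans_eq ?_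
  rw [NNReal.coe_one, one_mul]

lemma continuous_segmentMap (p q : UnitSquare) : Continuous (segmentMap p q) :=
  (LipschitzWith.of_dist_le' (K := dist p q) fun s t => by
    simpa [Real.dist_eq] using dist_segmentMap_le p q s t).continuous

lemma chainDist_sheetMap_le (w : ℕ → Bool) (n : ℕ) (p q : UnitSquare) :
    ((sheetMap w p).toStage n).chainDist ((sheetMap w q).toStage n) ≤ dist p q := by
  let γ (t : ℝ) : Stage n := (sheetMap w (segmentMap p q t)).toStage n
  have h := le_mul_of_finite_closed_cover (D := fun s t => (γ s).chainDist (γ t))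
    (C := dist p q) (K := fun k : Fin (n + 1) → Fin 2 → Fin 3 => segmentMap p q ⁻¹' cell k)
    zero_le_one (Stage.chainDist_self _).le (fun _ _ _ => Stage.chainDist_triangle _ _ _)
    (fun k => (isClosed_cell k).preimage (continuous_segmentMap p q))
    (fun t _ => mem_iUnion.2 (exists_mem_cell n (segmentMap p q t)))
    (fun k s hs t ht => (chainDist_sheetMap_le_of_mem_cell w hs ht).trans
      (dist_segmentMap_le p q s t))
  have h0 : segmentMap p q 0 = p := Subtype.ext (by simp [segmentMap])
  have h1 : segmentMap p q 1 = q := Subtype.ext (by simp [segmentMap])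
  simpa [γ, h0, h1] using h

lemma dist_proj_le_dist₀ (x y : Pillow) : dist x.proj y.proj ≤ Pillow.dist₀ x y := by
  have h := Stage.dist_collapse_le 0 (x.toStage 0) (y.toStage 0)
  rw [Fin.val_zero, pow_zero, one_mul] at h
  exact h.trans (Pillow.chainDist_le_dist₀ 0 x y)

lemma dist₀_sheetMap (w : ℕ → Bool) (p q : UnitSquare) :
    Pillow.dist₀ (sheetMap w p) (sheetMap w q) = dist p q :=
  le_antisymm (le_of_tendsto' (Pillow.tendsto_dist₀ _ _) fun n => chainDist_sheetMap_le w n p q)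
    (dist_proj_le_dist₀ (sheetMap w p) (sheetMap w q))

end PillowSpace

open PillowSpace in
theorem mainTheorem7 (dSL : MetricSpace PillowSpace.Pillow)
    (hsymm : PillowSpace.IsSymmetricMetric dSL)
    (hLoewner : @PillowSpace.IsLoewner PillowSpace.Pillow dSL)
    (hqs : PillowSpace.IsQuasisymmetricById PillowSpace.pillowMetric dSL) :
    ∃ ρ : MetricSpace PillowSpace.UnitSquare,
      PillowSpace.IsQuasisymmetricById PillowSpace.squareMetric ρ ∧
      @PillowSpace.IsLipschitzQuotient PillowSpace.Pillow PillowSpace.UnitSquare dSL ρ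
        PillowSpace.Pillow.proj ∧
      ∀ A : Set PillowSpace.Pillow, PillowSpace.IsSheet A →
        (∀ x ∈ A, ∀ y ∈ A, ρ.dist x.proj y.proj = dSL.dist x y) ∧
          PillowSpace.Pillow.proj '' A = Set.univ := by
  let s₀ : UnitSquare → Pillow := sheetMap fun _ => false
  have hs₀ : Function.Injective s₀ := Function.LeftInverse.injective (g := Pillow.proj)
    fun _ => rfl
  let ρ : MetricSpace UnitSquare := MetricSpace.induced s₀ hs₀ dSL
  have hρ : ∀ w p q, ρ.dist p q = dSL.dist (sheetMap w p) (sheetMap w q) := by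
    intro w p q
    rw [← flip_sheetMap_false w p, ← flip_sheetMap_false w q]
    exact (@Isometry.dist_eq _ _ dSL.toPseudoMetricSpace dSL.toPseudoMetricSpace _ (hsymm w)
      _ _).symm
  refine ⟨ρ, hqs.induced (dist₀_sheetMap _) hs₀, ?_, ?_⟩
  · obtain ⟨K, hK⟩ := hqs.exists_dist_le
    have hLip : ∀ x z : Pillow, ρ.dist z.proj x.proj ≤ K * dSL.dist z x := by
      intro x z
      obtain ⟨w, hw⟩ := exists_sheetMap_eq z
      rw [hρ w, hw]
      refine hK z (sheetMap w x.proj) x ?_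
      calc Pillow.dist₀ z (sheetMap w x.proj)
          = Pillow.dist₀ (sheetMap w z.proj) (sheetMap w x.proj) := by rw [hw]
        _ = dist z.proj x.proj := dist₀_sheetMap w _ _
        _ ≤ Pillow.dist₀ z x := dist_proj_le_dist₀ z x
    have hL : 0 < max 1 K := lt_max_of_lt_left one_pos
    refine ⟨max 1 K, hL, fun x r hr => ⟨fun q hq => ?_, ?_⟩⟩
    · obtain ⟨w, hw⟩ := exists_sheetMap_eq x
      refine ⟨sheetMap w q, ?_, rfl⟩
      have hq' : ρ.dist q x.proj < (max 1 K)⁻¹ * r := hq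
      rw [hρ w, hw] at hq'
      exact hq'.trans_le (mul_le_of_le_one_left hr.le (inv_le_one_of_one_le₀ (le_max_left 1 K)))
    · rintro _ ⟨z, hz, rfl⟩
      have hz' : dSL.dist z x < r := hz
      have hnonneg : 0 ≤ dSL.dist z x := @dist_nonneg _ dSL.toPseudoMetricSpace z x
      calc ρ.dist z.proj x.proj ≤ K * dSL.dist z x := hLip x z
        _ ≤ max 1 K * dSL.dist z x := by gcongr; exact le_max_right 1 K
        _ < max 1 K * r := by gcongr
  · rintro _ ⟨w, rfl⟩
    refine ⟨?_, Set.eq_univ_of_forall fun p => ⟨sheetMap w p, Set.mem_range_self p, rfl⟩⟩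
    rintro _ ⟨p, rfl⟩ _ ⟨q, rfl⟩
    exact hρ w p q
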